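/- Fix a horizon $T\ge 1$ and real matrices $A\in\mathbb R^{d_x\times d_x}$, $B\in\mathbb R^{d_x\times d_w}$, $C_y\in\mathbb R^{d_y\times d_x}$, $C_s\in\mathbb R^{d_s\times d_x}$, and consider the state-space model $$x_{t+1}=Ax_t+Bw_t,\qquad y_t=C_yx_t+v_t,\qquad s_t=C_sx_t,\qquad 0\le t\le T-1,$$ driven by the disturbance vector $\xi=(x_0,w_0,\dots,w_{T-2},v_0,\dots,v_{T-1})\in\Xi_T:=\mathbb R^{d_x+(T-1)d_w+Td_y}$. Let $\Pi_T$ be the class of all causal estimators, that is, sequences $\pi=(\pi_0,\dots,\pi_{T-1})$ of Borel measurable, possibly nonlinear maps giving the estimates $\widehat s_t=\pi_t(y_0,\dots,y_t)\in\mathbb R^{d_s}$, and let $e_T(\xi,\pi)=(\widehat s_t-s_t)_{0\le t\le T-1}\in\mathbb R^{Td_s}$ be the estimation error. Let $\mathscr K_T\subset\Pi_T$ be the linear causal estimators, $(\widehat s_0,\dots,\widehat s_{T-1})=K\,(y_0,\dots,y_{T-1})$ with $K\in\mathbb R^{Td_s\times Td_y}$ block lower triangular. For a probability distribution $P^\circ$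 on $\Xi_T$ with finite second moment and $\rho>0$ let $$\mathcal W(P^\circ,\rho)=\{P : P\text{ a probability distribution on }\Xi_T\text{ with finite second moment and } \mathsf W_2(P,P^\circ)\le\rho\},$$ where $\mathsf W_2$ is the Wasserstein-2 distance for the Euclidean norm. **Theorem.** Suppose that the nominal distribution $P^\circ$ is Gaussian (possibly degenerate) with mean zero, and let $\rho>0$. Then $$\inf_{\pi\in\Pi_T}\ \sup_{P\in\mathcal W(P^\circ,\rho)}\mathbb E_{P}\|e_T(\xi,\pi)\|^2=\sup_{P\in\mathcal W(P^\circ,\rho)}\ \inf_{\pi\in\Pi_T}\mathbb E_{P}\|e_T(\xi,\pi)\|^2 .$$ Moreover there is a saddle point $(\pi^\star,P^\star)\in\Pi_T\times\mathcal W(P^\circ,\rho)$, that is, $$\mathbb E_{P}\|e_T(\xi,\pi^\star)\|^2\le \mathbb E_{P^\star}\|e_T(\xi,\pi^\star)\|^2\le \mathbb E_{P^\star}\|e_T(\xi,\pi)\|^2\qquad\text{for all }P\in\mathcal W(P^\circ,\rho),\ \pi\in\Pi_T,$$ such that $P^\star$ is Gaussian with mean zero and $\pi^\star$ is linear, $\pi^\star\in\mathscr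 K_T$. -/

import Mathlib

open MeasureTheory ProbabilityTheory
open scoped ENNReal

namespace DRFilter

/-- The index set of the coordinates of the disturbance vector over the horizon `T`:
the initial state `x₀`, the process noises `w₀, …, w_{T-2}`, and the measurement noises
`v₀, …, v_{T-1}`. -/
abbrev DistIdx (dx dw dy T : ℕ) : Type :=
  Fin dx ⊕ ((Fin (T - 1) × Fin dw) ⊕ (Fin T × Fin dy))

/-- The space of disturbances `ξ = [x₀; w₀; …; w_{T-2}; v₀; …; v_{T-1}]`, with its Euclidean
norm. -/
abbrev Dist (dx dw dy T : ℕ) : Type := EuclideanSpace ℝ (DistIdx dx dw dy T)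

/-- The matrices of a linear state-space model
`x_{t+1} = A x_t + B w_t`, `y_t = C_y x_t + v_t`, `s_t = C_s x_t`. -/
structure StateSpace (dx dw dy ds : ℕ) where
  A : Matrix (Fin dx) (Fin dx) ℝ
  B : Matrix (Fin dx) (Fin dw) ℝ
  Cy : Matrix (Fin dy) (Fin dx) ℝ
  Cs : Matrix (Fin ds) (Fin dx) ℝ

section Model

variable {dx dw dy ds T : ℕ}

/-- The initial state `x₀`. -/
def initialState (ξ : Dist dx dw dy T) : Fin dx → ℝ := fun i => ξ (Sum.inl i)

/-- The process noise `w_t`. It is part of the disturbance for `t < T - 1`; later values do not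
influence the signals up to time `T - 1`, and are set to `0`. -/
def processNoise (ξ : Dist dx dw dy T) (t : ℕ) : Fin dw → ℝ :=
  if h : t < T - 1 then fun i => ξ (Sum.inr (Sum.inl (⟨t, h⟩, i))) else 0

/-- The measurement noise `v_t`. -/
def measurementNoise (ξ : Dist dx dw dy T) (t : Fin T) : Fin dy → ℝ :=
  fun i => ξ (Sum.inr (Sum.inr (t, i)))

/-- The latent state `x_t`. -/
def state (S : StateSpace dx dw dy ds) (ξ : Dist dx dw dy T) : ℕ → Fin dx → ℝ
  | 0 => initialState ξ
  | t + 1 => S.A.mulVec (state S ξ t) + S.B.mulVec (processNoise ξ t)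

/-- The measurement `y_t`. -/
def measurement (S : StateSpace dx dw dy ds) (ξ : Dist dx dw dy T) (t : Fin T) : Fin dy → ℝ :=
  S.Cy.mulVec (state S ξ t) + measurementNoise ξ t

/-- The target signal `s_t`. -/
def target (S : StateSpace dx dw dy ds) (ξ : Dist dx dw dy T) (t : Fin T) : Fin ds → ℝ :=
  S.Cs.mulVec (state S ξ t)

end Model

/-- A (nonlinear) causal filtering policy `π = (π_t)_{t < T}`: measurable maps that produce the
estimate of `s_t` from the past and present measurements `y_0, …, y_t`. -/
structure CausalFilter (dy ds T : ℕ) where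
  toFun : (t : Fin T) → ({r : Fin T // r ≤ t} → Fin dy → ℝ) → Fin ds → ℝ
  measurable_toFun : ∀ t, Measurable (toFun t)

section Filter

variable {dx dw dy ds T : ℕ}

/-- The estimate of `s_t` from the measurement trajectory `y`. -/
def CausalFilter.estimate (π : CausalFilter dy ds T) (y : Fin T → Fin dy → ℝ) (t : Fin T) :
    Fin ds → ℝ :=
  π.toFun t (fun r => y r.1)

/-- The class of linear causal filters: block lower-triangular `T d_s × T d_y` matrices. -/
def linearFilters (dy ds T : ℕ) : Set (Matrix (Fin T × Fin ds) (Fin T × Fin dy) ℝ) :=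
  {K | ∀ (t r : Fin T) (i : Fin ds) (j : Fin dy), t < r → K (t, i) (r, j) = 0}

/-- A causal filter is linear if it is `y ↦ K y` for a block lower-triangular matrix `K`. -/
def CausalFilter.IsLinear (π : CausalFilter dy ds T) : Prop :=
  ∃ K ∈ linearFilters dy ds T, ∀ (y : Fin T → Fin dy → ℝ) (t : Fin T) (i : Fin ds),
    π.estimate y t i = K.mulVec (fun p : Fin T × Fin dy => y p.1 p.2) (t, i)

/-- The estimation error `e(ξ, π) = ŝ - s`, stacked over the horizon, with its Euclidean norm. -/
def estimationError (S : StateSpace dx dw dy ds) (π : CausalFilter dy ds T)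
    (ξ : Dist dx dw dy T) : EuclideanSpace ℝ (Fin T × Fin ds) :=
  WithLp.toLp 2 fun p => π.estimate (measurement S ξ) p.1 p.2 - target S ξ p.1 p.2

/-- The mean-squared error `E_P ‖e(ξ, π)‖²`, with value `∞` if the error is not square
integrable. -/
noncomputable def mse (S : StateSpace dx dw dy ds) (π : CausalFilter dy ds T)
    (P : Measure (Dist dx dw dy T)) : ℝ≥0∞ :=
  ∫⁻ ξ, ‖estimationError S π ξ‖ₑ ^ 2 ∂P

end Filter

section Wasserstein

variable {E : Type*} [NormedAddCommGroup E] [MeasurableSpace E]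

/-- The joint distributions with marginals `P` and `Q`. -/
def couplings (P Q : Measure E) : Set (Measure (E × E)) :=
  {γ | γ.map Prod.fst = P ∧ γ.map Prod.snd = Q}

/-- The Wasserstein-2 distance. -/
noncomputable def W2 (P Q : Measure E) : ℝ≥0∞ :=
  (⨅ γ ∈ couplings P Q, ∫⁻ z, ‖z.1 - z.2‖ₑ ^ 2 ∂γ) ^ (1 / 2 : ℝ)

/-- The Wasserstein-2 ball of radius `ρ` about `P₀`, among the probability distributions with
finite second moment. -/
def ambiguitySet (P₀ : Measure E) (ρ : ℝ) : Set (Measure E) :=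
  {P | IsProbabilityMeasure P ∧ MemLp id 2 P ∧ W2 P P₀ ≤ ENNReal.ofReal ρ}

end Wasserstein

end DRFilter

namespace DRFilter

/-! ### Compactness and convexity of the moment matrices of couplings -/

section CouplingMoments

open Matrix

variable {I n : Type*} [Fintype I] [Fintype n]

/-! The mean-squared error of a linear filter depends on `P` only through its second-moment matrix,
and is convex in the filter and affine in that matrix. The moment matrices available to the
adversary are exactly the upper-left blocks of joint matrices `J` in `couplingMoments`, a compact
convex set: every coupling yields such a `J` (`exists_couplingMoments`), and every such `J` is the
moment matrix of a Gaussian coupling with second marginal `P₀` (`exists_gaussian_mem_ambiguitySet`).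

Sion's theorem therefore gives a saddle point between linear causal filters and moment matrices
(`exists_linear_saddle`). Sion is applied on a box of filters. The saddle filter lies in the
interior of the box, because the adversary may play a positive definite moment matrix and
measurement noise makes large gains costly. Hence stationarity holds in every causal entry, which is
the system of normal equations.

Nonlinear filters bring nothing more: under the Gaussian realization of the worst moments, the
normal equations say that the error at each time is uncorrelated with, hence independent of, the
measurements up to that time. Any other causal filter adds a function of those measurements to the
error, and this cannot lower the mean square (`mse_linearFilter_le_of_normal_equations`). -/

lemma posSemidef_two_entries {J : Matrix n n ℝ} (hJ : J.PosSemidef) (i j : n) (a b : ℝ) :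
    0 ≤ a ^ 2 * J i i + 2 * (a * b) * J i j + b ^ 2 * J j j := by
  classical
  have h := hJ.dotProduct_mulVec_nonneg (Pi.single i a + Pi.single j b)
  have hs : J j i = J i j := by simpa using hJ.isHermitian.apply i j
  simp only [star_trivial, mulVec_add, add_dotProduct, single_dotProduct, Pi.add_apply,
    mulVec_single, op_smul_eq_smul, Pi.smul_apply, col_apply, smul_eq_mul, hs] at h
  linarith

/-- The trace `tr (J₁₁ - 2 J₁₂ + J₂₂)` of a block matrix: the transport cost of a coupling with
second-moment matrix `J`. -/
def transportCost (J : Matrix (I ⊕ I) (I ⊕ I) ℝ) : ℝ :=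
  ∑ i, (J (.inl i) (.inl i) - 2 * J (.inl i) (.inr i) + J (.inr i) (.inr i))

/-- The second-moment matrices of couplings with second marginal moment `M₀` and transport cost
at most `c`. -/
def couplingMoments (M₀ : Matrix I I ℝ) (c : ℝ) : Set (Matrix (I ⊕ I) (I ⊕ I) ℝ) :=
  {J | J.PosSemidef ∧ J.toBlocks₂₂ = M₀ ∧ transportCost J ≤ c}

lemma continuous_transportCost :
    Continuous (transportCost : Matrix (I ⊕ I) (I ⊕ I) ℝ → ℝ) := by
  unfold transportCost
  fun_prop

lemma transportCost_add_smul (a b : ℝ) (J J' : Matrix (I ⊕ I) (I ⊕ I) ℝ) :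
    transportCost (a • J + b • J') = a * transportCost J + b * transportCost J' := by
  simp only [transportCost, Matrix.add_apply, Matrix.smul_apply, smul_eq_mul, Finset.mul_sum,
    ← Finset.sum_add_distrib]
  exact Finset.sum_congr rfl fun i _ => by ring

lemma convex_couplingMoments (M₀ : Matrix I I ℝ) (c : ℝ) :
    Convex ℝ (couplingMoments M₀ c) := by
  rintro J ⟨hJ, hJ₀, hJc⟩ J' ⟨hJ', hJ₀', hJc'⟩ a b ha hb hab
  refine ⟨(hJ.smul ha).add (hJ'.smul hb), ?_, ?_⟩
  · ext i j
    have h1 := congrFun (congrFun hJ₀ i) j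
    have h2 := congrFun (congrFun hJ₀' i) j
    simp only [toBlocks₂₂, of_apply] at h1 h2
    simp only [toBlocks₂₂, of_apply, Matrix.add_apply, Matrix.smul_apply, smul_eq_mul, h1, h2]
    rw [← add_mul, hab, one_mul]
  · rw [transportCost_add_smul]
    calc a * transportCost J + b * transportCost J' ≤ a * c + b * c := by gcongr
      _ = c := by rw [← add_mul, hab, one_mul]

lemma isClosed_posSemidef : IsClosed {J : Matrix n n ℝ | J.PosSemidef} := by
  have : {J : Matrix n n ℝ | J.PosSemidef} =
      {J | Jᵀ = J} ∩ ⋂ x : n → ℝ, {J | 0 ≤ x ⬝ᵥ (J *ᵥ x)} := by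
    ext J
    simp only [Set.mem_ofPred_eq, Set.mem_inter_iff, Set.mem_iInter]
    refine ⟨fun h => ⟨by
      simpa [conjTranspose_eq_transpose_of_trivial] using h.isHermitian.eq,
      fun x => by simpa using h.dotProduct_mulVec_nonneg x⟩, fun h => ?_⟩
    exact .of_dotProduct_mulVec_nonneg (by
      simpa [IsHermitian, conjTranspose_eq_transpose_of_trivial] using h.1)
      fun x => by simpa using h.2 x
  rw [this]
  refine (isClosed_eq (by fun_prop) (by fun_prop)).inter (isClosed_iInter fun x => ?_)
  exact isClosed_le continuous_const (by fun_prop)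

lemma isClosed_couplingMoments (M₀ : Matrix I I ℝ) (c : ℝ) : IsClosed (couplingMoments M₀ c) := by
  refine isClosed_posSemidef.inter ((isClosed_eq ?_ continuous_const).inter
    (isClosed_le continuous_transportCost continuous_const))
  unfold toBlocks₂₂
  fun_prop

/-- On the diagonal this is `‖X‖² ≤ 2‖X - Y‖² + 2‖Y‖²`, coordinate by coordinate; off the diagonal,
`2|J a b| ≤ J a a + J b b` by positivity. -/
lemma abs_apply_le_of_mem_couplingMoments {M₀ : Matrix I I ℝ} {c : ℝ}
    {J : Matrix (I ⊕ I) (I ⊕ I) ℝ} (hJ : J ∈ couplingMoments M₀ c) (a b : I ⊕ I) :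
    |J a b| ≤ 2 * c + 2 * M₀.trace := by
  obtain ⟨hJ, hJ₀, hJc⟩ := hJ
  have hM (i : I) : J (.inr i) (.inr i) = M₀ i i := congrFun (congrFun hJ₀ i) i
  have hterm (i : I) :
      0 ≤ J (.inl i) (.inl i) - 2 * J (.inl i) (.inr i) + J (.inr i) (.inr i) := by
    linarith [posSemidef_two_entries hJ (.inl i) (.inr i) 1 (-1)]
  have hcost (i : I) :
      J (.inl i) (.inl i) - 2 * J (.inl i) (.inr i) + J (.inr i) (.inr i) ≤ c :=
    (Finset.single_le_sum (f := fun i => J (.inl i) (.inl i) - 2 * J (.inl i) (.inr i)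
      + J (.inr i) (.inr i)) (fun i _ => hterm i) (Finset.mem_univ i)).trans hJc
  have hdiag (i : I) : 0 ≤ M₀ i i := by
    rw [← hM]; linarith [posSemidef_two_entries hJ (.inr i) (.inr i) 1 0]
  have htr (i : I) : M₀ i i ≤ M₀.trace :=
    Finset.single_le_sum (f := fun i => M₀ i i) (fun i _ => hdiag i) (Finset.mem_univ i)
  have hbd (a : I ⊕ I) : J a a ≤ 2 * c + 2 * M₀.trace := by
    rcases a with i | i
    · linarith [posSemidef_two_entries hJ (.inl i) (.inr i) 1 (-2), hcost i, htr i, hM i]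
    · linarith [hcost i, hterm i, htr i, hM i, hdiag i]
  rw [abs_le]
  constructor
  · linarith [posSemidef_two_entries hJ a b 1 1, hbd a, hbd b]
  · linarith [posSemidef_two_entries hJ a b 1 (-1), hbd a, hbd b]

lemma isCompact_couplingMoments (M₀ : Matrix I I ℝ) (c : ℝ) :
    IsCompact (couplingMoments M₀ c) := by
  refine IsCompact.of_isClosed_subset
    (isCompact_univ_pi fun _ => isCompact_univ_pi fun _ => isCompact_Icc)
    (isClosed_couplingMoments M₀ c) fun J hJ a _ b _ =>
      Set.mem_Icc.2 (abs_le.1 (abs_apply_le_of_mem_couplingMoments hJ a b))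

/-- Add to the nominal vector an uncorrelated noise of variance `ε` in each coordinate. The total
cost `card I * ε` stays below `c`, and the resulting moment matrix is positive definite even if `M₀`
is singular. -/
lemma exists_inflated_mem_couplingMoments [DecidableEq I] {M₀ : Matrix I I ℝ}
    (hM₀ : M₀.PosSemidef) {c : ℝ} (hc : 0 < c) :
    ∃ ε > (0 : ℝ), ∃ J ∈ couplingMoments M₀ c, J.toBlocks₁₁ = M₀ + ε • 1 := by
  refine ⟨c / (Fintype.card I + 1), by positivity, fromBlocks
    (M₀ + (c / (Fintype.card I + 1)) • 1) M₀ M₀ M₀, ⟨?_, by simp, ?_⟩, by simp⟩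
  · have h1 : (fromBlocks M₀ M₀ M₀ M₀).PosSemidef := by
      convert hM₀.submatrix (Sum.elim id id : I ⊕ I → I) using 1
      ext (i | i) (j | j) <;> simp
    have h2 : (diagonal (Sum.elim (fun _ => c / (Fintype.card I + 1)) fun _ => 0) :
        Matrix (I ⊕ I) (I ⊕ I) ℝ).PosSemidef := by
      refine posSemidef_diagonal_iff.2 fun i => ?_
      rcases i with i | i <;> simp
      positivity
    convert h1.add h2 using 1
    ext (i | i) (j | j) <;> simp [diagonal_apply, one_apply]
  · simp only [transportCost, fromBlocks_apply₁₁, fromBlocks_apply₁₂, fromBlocks_apply₂₂,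
      Matrix.add_apply, Matrix.smul_apply, one_apply_eq, smul_eq_mul, mul_one]
    have : (∑ i : I, (M₀ i i + c / (Fintype.card I + 1) - 2 * M₀ i i + M₀ i i))
        = Fintype.card I * (c / (Fintype.card I + 1)) := by
      rw [Finset.sum_congr rfl fun i _ => (by ring : _ = c / ((Fintype.card I : ℝ) + 1))]
      simp
    rw [this, mul_div_assoc', div_le_iff₀ (by positivity)]
    linarith

end CouplingMoments

/-! ### Saddle point for linear estimators and second moments -/

section Minimax

open Matrix

variable {I p q : Type*} [Fintype I] [Fintype p] [Fintype q]

/-- The mean-squared error `tr ((K H - G) M (K H - G)ᵀ)` of the linear estimator `K` of `G ξ`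
from `H ξ`, if `M` is the second-moment matrix of `ξ`. -/
def linearRisk (H : Matrix q I ℝ) (G : Matrix p I ℝ) (K : Matrix p q ℝ) (M : Matrix I I ℝ) : ℝ :=
  ∑ a, (K * H - G) a ⬝ᵥ (M *ᵥ (K * H - G) a)

lemma continuous_linearRisk (H : Matrix q I ℝ) (G : Matrix p I ℝ) :
    Continuous fun z : Matrix p q ℝ × Matrix I I ℝ => linearRisk H G z.1 z.2 := by
  unfold linearRisk
  refine continuous_finsetSum _ fun a _ => ?_
  have : Continuous fun z : Matrix p q ℝ × Matrix I I ℝ => (z.1 * H - G) a :=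
    (continuous_apply a).comp (by fun_prop : Continuous fun z : Matrix p q ℝ × Matrix I I ℝ =>
      z.1 * H - G)
  fun_prop

lemma linearRisk_add_smul_moment (H : Matrix q I ℝ) (G : Matrix p I ℝ) (K : Matrix p q ℝ)
    (a b : ℝ) (M M' : Matrix I I ℝ) :
    linearRisk H G K (a • M + b • M') = a * linearRisk H G K M + b * linearRisk H G K M' := by
  simp only [linearRisk, add_mulVec, smul_mulVec, dotProduct_add, dotProduct_smul, smul_eq_mul,
    Finset.sum_add_distrib, Finset.mul_sum]

/-- The gap between the two sides is `a * b` times the quadratic form at `u - v`. -/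
lemma quadForm_convex {M : Matrix I I ℝ} (hM : M.PosSemidef) (u v : I → ℝ) {a b : ℝ}
    (ha : 0 ≤ a) (hb : 0 ≤ b) (hab : a + b = 1) :
    (a • u + b • v) ⬝ᵥ (M *ᵥ (a • u + b • v)) ≤ a * (u ⬝ᵥ (M *ᵥ u)) + b * (v ⬝ᵥ (M *ᵥ v)) := by
  have h := hM.dotProduct_mulVec_nonneg (u - v)
  simp only [star_trivial, mulVec_sub, mulVec_add, mulVec_smul, dotProduct_sub, sub_dotProduct,
    dotProduct_add, add_dotProduct, dotProduct_smul, smul_dotProduct, smul_eq_mul] at h ⊢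
  obtain rfl : b = 1 - a := by linarith
  nlinarith [mul_nonneg (mul_nonneg ha hb) h]

lemma convexOn_linearRisk (H : Matrix q I ℝ) (G : Matrix p I ℝ) {M : Matrix I I ℝ}
    (hM : M.PosSemidef) {X : Set (Matrix p q ℝ)} (hX : Convex ℝ X) :
    ConvexOn ℝ X fun K => linearRisk H G K M := by
  refine ⟨hX, fun K _ K' _ a b ha hb hab => ?_⟩
  simp only [linearRisk, smul_eq_mul, Finset.mul_sum, ← Finset.sum_add_distrib]
  refine Finset.sum_le_sum fun c _ => ?_
  have : ((a • K + b • K') * H - G) c = a • (K * H - G) c + b • (K' * H - G) c := by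
    have h : (a • K + b • K') * H - G = a • (K * H - G) + b • (K' * H - G) := by
      rw [Matrix.add_mul, Matrix.smul_mul, Matrix.smul_mul, smul_sub, smul_sub]
      nth_rewrite 1 [← one_smul ℝ G]
      rw [← hab, add_smul]
      abel
    rw [h]; rfl
  rw [this]
  exact quadForm_convex hM _ _ ha hb hab

/-- Only row `a` of the error matrix moves, by `τ • H b`. The coefficient of `2 * τ` is the residual
of one normal equation. -/
lemma linearRisk_add_single [DecidableEq p] [DecidableEq q] (H : Matrix q I ℝ)
    (G : Matrix p I ℝ) (K : Matrix p q ℝ) {M : Matrix I I ℝ} (hM : M.PosSemidef) (a : p) (b : q)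
    (τ : ℝ) :
    linearRisk H G (K + Matrix.single a b τ) M = linearRisk H G K M
      + (2 * τ * (H b ⬝ᵥ (M *ᵥ (K * H - G) a)) + τ ^ 2 * (H b ⬝ᵥ (M *ᵥ H b))) := by
  have hrow (c : p) : ((K + Matrix.single a b τ) * H - G) c
      = (K * H - G) c + if c = a then τ • H b else 0 := by
    ext i
    by_cases hc : c = a
    · subst hc
      simp [Matrix.add_mul, sub_add_eq_add_sub]
    · simp [Matrix.add_mul, hc]
  have hsymm (u v : I → ℝ) : u ⬝ᵥ (M *ᵥ v) = v ⬝ᵥ (M *ᵥ u) := by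
    have hT : Mᵀ = M := by simpa [conjTranspose_eq_transpose_of_trivial] using hM.isHermitian.eq
    rw [← dotProduct_transpose_mulVec, hT]
  have : ∀ c, ((K + Matrix.single a b τ) * H - G) c ⬝ᵥ
      (M *ᵥ ((K + Matrix.single a b τ) * H - G) c) = (K * H - G) c ⬝ᵥ (M *ᵥ (K * H - G) c)
      + if c = a then (2 * τ * (H b ⬝ᵥ (M *ᵥ (K * H - G) a)) + τ ^ 2 * (H b ⬝ᵥ (M *ᵥ H b)))
        else 0 := by
    intro c
    rw [hrow]
    split_ifs with hc
    · subst hc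
      simp only [mulVec_add, mulVec_smul, dotProduct_add, add_dotProduct, dotProduct_smul,
        smul_dotProduct, smul_eq_mul]
      rw [hsymm ((K * H - G) c) (H b)]
      ring
    · simp
  simp only [linearRisk, this, Finset.sum_add_distrib]
  simp

lemma eq_zero_of_forall_small_quadratic_nonneg {b c δ : ℝ} (hδ : 0 < δ)
    (h : ∀ τ, |τ| ≤ δ → 0 ≤ 2 * τ * b + τ ^ 2 * c) : b = 0 := by
  by_contra hb
  -- At `τ = -(r * b)` the quadratic equals `r * b² * (r * c - 2)`, negative once `r * c < 1`; this
  -- `r` also keeps `|τ| ≤ δ`.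
  set r := δ / (|b| + δ * |c| + 1) with hr
  have hden : 0 < |b| + δ * |c| + 1 := by positivity
  have hr0 : 0 < r := by positivity
  have hrb : r * |b| ≤ δ := by
    rw [hr, div_mul_eq_mul_div, div_le_iff₀ hden]
    nlinarith [abs_nonneg b, abs_nonneg c, mul_nonneg hδ.le (abs_nonneg c)]
  have hrc : r * |c| < 1 := by
    rw [hr, div_mul_eq_mul_div, div_lt_one hden]
    linarith [abs_nonneg b]
  have h1 := h (-(r * b)) (by rwa [abs_neg, abs_mul, abs_of_pos hr0])
  have hb2 : 0 < b ^ 2 := by positivity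
  have hc1 : r * c < 1 := lt_of_le_of_lt (by gcongr; exact le_abs_self c) hrc
  nlinarith [mul_pos hr0 hb2]

/-- Matrices whose entries vanish outside a given pattern. -/
def patternMatrices (R : p → q → Prop) : Set (Matrix p q ℝ) :=
  {K | ∀ a b, ¬ R a b → K a b = 0}

/-- Minimax theorem for linear estimators with a sparsity pattern: there is a worst-case
second-moment matrix, for which the optimal linear estimator satisfies the normal equations. -/
theorem exists_linear_saddle [DecidableEq I] [DecidableEq q] (R : p → q → Prop) (H : Matrix q I ℝ)
    (G : Matrix p I ℝ)
    (ν : q → I) (hH : ∀ b b', H b (ν b') = if b = b' then 1 else 0) (hG : ∀ a b, G a (ν b) = 0)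
    {M₀ : Matrix I I ℝ} (hM₀ : M₀.PosSemidef) {c : ℝ} (hc : 0 < c) :
    ∃ K ∈ patternMatrices R, ∃ J ∈ couplingMoments M₀ c,
      (∀ J' ∈ couplingMoments M₀ c,
        linearRisk H G K J'.toBlocks₁₁ ≤ linearRisk H G K J.toBlocks₁₁) ∧
      ∀ a b, R a b → H b ⬝ᵥ (J.toBlocks₁₁ *ᵥ (K * H - G) a) = 0 := by
  classical
  have hblock (J : Matrix (I ⊕ I) (I ⊕ I) ℝ) (hJ : J.PosSemidef) : J.toBlocks₁₁.PosSemidef :=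
    hJ.submatrix Sum.inl
  have hcontb : Continuous fun J : Matrix (I ⊕ I) (I ⊕ I) ℝ => J.toBlocks₁₁ := by
    unfold toBlocks₁₁; fun_prop
  obtain ⟨ε, hε, Jε, hJε, hJε'⟩ := exists_inflated_mem_couplingMoments hM₀ hc
  have hYne : (couplingMoments M₀ c).Nonempty := ⟨Jε, hJε⟩
  obtain ⟨C, hC⟩ := ((isCompact_couplingMoments M₀ c).image_of_continuousOn
    (f := fun J => linearRisk H G 0 J.toBlocks₁₁) (by
      exact ((continuous_linearRisk H G).comp
        (continuous_const.prodMk hcontb)).continuousOn)).bddAbove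
  have hC' (J) (hJ : J ∈ couplingMoments M₀ c) : linearRisk H G 0 J.toBlocks₁₁ ≤ C :=
    hC ⟨J, hJ, rfl⟩
  -- Coercivity: in the noise columns `ν b` the matrix `K * H - G` is `K` itself, and the inflated
  -- moment matrix dominates `ε • 1`.
  have hcoer (K : Matrix p q ℝ) (a : p) (b : q) :
      ε * K a b ^ 2 ≤ linearRisk H G K Jε.toBlocks₁₁ := by
    have hrow (a : p) : ε * ∑ i, (K * H - G) a i ^ 2
        ≤ (K * H - G) a ⬝ᵥ (Jε.toBlocks₁₁ *ᵥ (K * H - G) a) := by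
      rw [hJε']
      have := hM₀.dotProduct_mulVec_nonneg ((K * H - G) a)
      simp only [star_trivial] at this
      simp only [add_mulVec, smul_mulVec, one_mulVec, dotProduct_add, dotProduct_smul,
        smul_eq_mul]
      have h2 : (K * H - G) a ⬝ᵥ (K * H - G) a = ∑ i, (K * H - G) a i ^ 2 := by
        simp [dotProduct, sq]
      rw [h2]
      linarith
    have hK : (K * H - G) a (ν b) = K a b := by
      simp [Matrix.mul_apply, hH, hG]
    calc ε * K a b ^ 2 = ε * (K * H - G) a (ν b) ^ 2 := by rw [hK]
      _ ≤ ε * ∑ i, (K * H - G) a i ^ 2 := by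
        gcongr
        exact Finset.single_le_sum (f := fun i => (K * H - G) a i ^ 2)
          (fun i _ => sq_nonneg _) (Finset.mem_univ _)
      _ ≤ _ := hrow a
      _ ≤ linearRisk H G K Jε.toBlocks₁₁ :=
        Finset.single_le_sum (f := fun a => (K * H - G) a ⬝ᵥ (Jε.toBlocks₁₁ *ᵥ (K * H - G) a))
          (fun a _ => le_trans (by positivity) (hrow a)) (Finset.mem_univ a)
  -- At a saddle point, comparison with the zero filter gives `ε * K a b ^ 2 ≤ C`, so `K a b ^ 2 < r
  -- ≤ r ^ 2`: the box constraint is never active.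
  set r : ℝ := |C| / ε + 1 with hr
  have hr1 : 1 ≤ r := by rw [hr]; linarith [div_nonneg (abs_nonneg C) hε.le]
  set X : Set (Matrix p q ℝ) := patternMatrices R ∩ {K | ∀ a b, K a b ∈ Set.Icc (-r) r} with hXdef
  have hXconv : Convex ℝ X := by
    rintro K ⟨hK, hKr⟩ K' ⟨hK', hKr'⟩ s t hs ht hst
    refine ⟨fun a b hab => ?_, fun a b => ?_⟩
    · simp [hK a b hab, hK' a b hab]
    · exact (convex_Icc (-r) r) (hKr a b) (hKr' a b) hs ht hst
  have hXcomp : IsCompact X := by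
    refine IsCompact.of_isClosed_subset (s := {K : Matrix p q ℝ | ∀ a b, K a b ∈ Set.Icc (-r) r})
      ?_ ?_ Set.inter_subset_right
    · have h := isCompact_univ_pi fun _ : p => isCompact_univ_pi fun _ : q =>
        isCompact_Icc (a := -r) (b := r)
      simp only [Set.pi, Set.mem_univ, true_imp_iff] at h
      exact h
    · have : X = (⋂ a, ⋂ b, ⋂ _ : ¬ R a b, {K : Matrix p q ℝ | K a b = 0}) ∩
          ⋂ a, ⋂ b, {K : Matrix p q ℝ | K a b ∈ Set.Icc (-r) r} := by
        ext K; simp [hXdef, patternMatrices]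
      rw [this]
      refine (isClosed_iInter fun a => isClosed_iInter fun b => isClosed_iInter fun _ =>
        isClosed_eq (by fun_prop) (by fun_prop)).inter
        (isClosed_iInter fun a => isClosed_iInter fun b => ?_)
      exact isClosed_Icc.preimage (by fun_prop : Continuous fun K : Matrix p q ℝ => K a b)
  have hX0 : (0 : Matrix p q ℝ) ∈ X :=
    ⟨fun a b _ => rfl, fun a b => ⟨by simp; linarith, by simp; linarith⟩⟩
  obtain ⟨K, hK, J, hJ, hsad⟩ := Sion.exists_isSaddlePointOn (X := X)
    (Y := couplingMoments M₀ c) (f := fun K J => linearRisk H G K J.toBlocks₁₁)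
    ⟨0, hX0⟩ hXconv hXcomp
    (fun J _ => ((continuous_linearRisk H G).comp
      (continuous_id.prodMk continuous_const)).lowerSemicontinuous.lowerSemicontinuousOn _)
    (fun J hJ => (convexOn_linearRisk H G (hblock J hJ.1) hXconv).quasiconvexOn)
    (convex_couplingMoments M₀ c) hYne (isCompact_couplingMoments M₀ c)
    (fun K _ => ((continuous_linearRisk H G).comp
      (continuous_const.prodMk hcontb)).upperSemicontinuous.upperSemicontinuousOn _)
    (fun K _ => ConcaveOn.quasiconcaveOn ⟨convex_couplingMoments M₀ c,
      fun J _ J' _ a b _ _ _ => le_of_eq (by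
        rw [smul_eq_mul, smul_eq_mul, ← linearRisk_add_smul_moment]; rfl)⟩)
  have hKr (a : p) (b : q) : |K a b| < r := by
    have h1 : ε * K a b ^ 2 ≤ |C| :=
      (hcoer K a b).trans ((hsad 0 hX0 Jε hJε).trans ((hC' J hJ).trans (le_abs_self C)))
    have h2 : K a b ^ 2 < r := by
      have : K a b ^ 2 ≤ |C| / ε := by rw [le_div_iff₀ hε]; linarith
      linarith
    exact abs_lt_of_sq_lt_sq (by nlinarith) (by linarith)
  refine ⟨K, hK.1, J, hJ, fun J' hJ' => hsad K hK J' hJ', fun a b hab => ?_⟩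
  -- Since the entry is strictly inside the box, small perturbations of either sign are admissible,
  -- and minimality forces the linear term to vanish.
  refine eq_zero_of_forall_small_quadratic_nonneg (δ := r - |K a b|)
    (c := H b ⬝ᵥ (J.toBlocks₁₁ *ᵥ H b)) (sub_pos.2 (hKr a b)) fun τ hτ => ?_
  have hmem : K + Matrix.single a b τ ∈ X := by
    refine ⟨fun a' b' hab' => ?_, fun a' b' => ?_⟩
    · have : ¬ (a = a' ∧ b = b') := by rintro ⟨rfl, rfl⟩; exact hab' hab
      simp [hK.1 a' b' hab', this, Matrix.single]
    · by_cases h : a = a' ∧ b = b'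
      · obtain ⟨rfl, rfl⟩ := h
        refine abs_le.1 ?_
        simp only [Matrix.add_apply, single_apply_same]
        linarith [abs_add_le (K a b) τ]
      · simpa [Matrix.single, h] using hK.2 a' b'
  have : linearRisk H G K J.toBlocks₁₁ ≤ linearRisk H G (K + Matrix.single a b τ) J.toBlocks₁₁ :=
    hsad _ hmem J hJ
  rw [linearRisk_add_single H G K (hblock J hJ.1)] at this
  linarith

end Minimax

end DRFilter
namespace DRFilter

/-! ### Second moments and centred Gaussian distributions -/

section Moments

open Matrix WithLp

variable {I n Ω : Type*} [Fintype I] [Fintype n] {mΩ : MeasurableSpace Ω} {μ : Measure Ω}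

/-- The matrix of (non-centred) second moments of a family of random variables. -/
noncomputable def momentMatrix (Z : n → Ω → ℝ) (μ : Measure Ω) : Matrix n n ℝ :=
  Matrix.of fun i j => ∫ ω, Z i ω * Z j ω ∂μ

/-- The matrix of (non-centred) second moments of a distribution on Euclidean space. -/
noncomputable abbrev secondMoment (P : Measure (EuclideanSpace ℝ I)) : Matrix I I ℝ :=
  momentMatrix (fun i x => x i) P

lemma integral_dotProduct_mul_dotProduct {Z : n → Ω → ℝ} (hZ : ∀ i, MemLp (Z i) 2 μ)
    (u v : n → ℝ) :
    ∫ ω, (u ⬝ᵥ fun i => Z i ω) * (v ⬝ᵥ fun i => Z i ω) ∂μ = u ⬝ᵥ (momentMatrix Z μ *ᵥ v) := by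
  have hint (i j : n) : Integrable (fun ω => u i * Z i ω * (v j * Z j ω)) μ := by
    convert! ((hZ i).integrable_mul (hZ j)).const_mul (u i * v j) using 1
    ext ω; simp; ring
  simp only [dotProduct, Finset.sum_mul_sum]
  simp only [mulVec, dotProduct, momentMatrix, of_apply, Finset.mul_sum]
  rw [integral_finsetSum _ fun i _ => integrable_finsetSum _ fun j _ => hint i j]
  refine Finset.sum_congr rfl fun i _ => ?_
  rw [integral_finsetSum _ fun j _ => hint i j]
  refine Finset.sum_congr rfl fun j _ => ?_
  rw [mul_comm _ (v j), ← mul_assoc, ← integral_const_mul]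
  exact integral_congr_ae (.of_forall fun ω => by ring)

lemma posSemidef_momentMatrix {Z : n → Ω → ℝ} (hZ : ∀ i, MemLp (Z i) 2 μ) :
    (momentMatrix Z μ).PosSemidef := by
  refine .of_dotProduct_mulVec_nonneg ?_ fun v => ?_
  · ext i j
    simp [momentMatrix, mul_comm]
  · rw [star_trivial, ← integral_dotProduct_mul_dotProduct hZ]
    exact integral_nonneg fun ω => mul_self_nonneg _

lemma lintegral_enorm_sq_eq_ofReal_integral {f : Ω → ℝ} (hf : MemLp f 2 μ) :
    ∫⁻ ω, ‖f ω‖ₑ ^ 2 ∂μ = ENNReal.ofReal (∫ ω, f ω ^ 2 ∂μ) := by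
  rw [ofReal_integral_eq_lintegral_ofReal hf.integrable_sq (.of_forall fun _ => sq_nonneg _)]
  refine lintegral_congr fun ω => ?_
  rw [← sq_abs, ENNReal.ofReal_pow (abs_nonneg _), Real.enorm_eq_ofReal_abs]

lemma enorm_toLp_sq (x : I → ℝ) :
    ‖(toLp 2 x : EuclideanSpace ℝ I)‖ₑ ^ 2 = ∑ i, ‖x i‖ₑ ^ 2 := by
  rw [← ofReal_norm, ← ENNReal.ofReal_pow (norm_nonneg _), EuclideanSpace.norm_sq_eq,
    ENNReal.ofReal_sum_of_nonneg fun _ _ => by positivity]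
  refine Finset.sum_congr rfl fun i _ => ?_
  rw [ENNReal.ofReal_pow (norm_nonneg _), ofReal_norm]

lemma lintegral_enorm_toLp_sq {D : I → Ω → ℝ} (hD : ∀ i, AEMeasurable (D i) μ) :
    ∫⁻ ω, ‖(toLp 2 (fun i => D i ω) : EuclideanSpace ℝ I)‖ₑ ^ 2 ∂μ =
      ∑ i, ∫⁻ ω, ‖D i ω‖ₑ ^ 2 ∂μ := by
  simp_rw [enorm_toLp_sq]
  exact lintegral_finsetSum' _ fun i _ => ((hD i).enorm).pow_const 2

lemma lintegral_enorm_toLp_sq_eq_ofReal {D : I → Ω → ℝ} (hD : ∀ i, MemLp (D i) 2 μ) :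
    ∫⁻ ω, ‖(toLp 2 (fun i => D i ω) : EuclideanSpace ℝ I)‖ₑ ^ 2 ∂μ =
      ENNReal.ofReal (∑ i, ∫ ω, D i ω ^ 2 ∂μ) := by
  rw [lintegral_enorm_toLp_sq fun i => (hD i).aestronglyMeasurable.aemeasurable,
    ENNReal.ofReal_sum_of_nonneg fun i _ => integral_nonneg fun ω => sq_nonneg _]
  exact Finset.sum_congr rfl fun i _ => lintegral_enorm_sq_eq_ofReal_integral (hD i)

lemma lintegral_enorm_sub_sq_eq_transportCost {Z : I ⊕ I → Ω → ℝ} (hZ : ∀ i, MemLp (Z i) 2 μ) :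
    ∫⁻ ω, ‖(toLp 2 (fun i => Z (.inl i) ω - Z (.inr i) ω) : EuclideanSpace ℝ I)‖ₑ ^ 2 ∂μ =
      ENNReal.ofReal (transportCost (momentMatrix Z μ)) := by
  rw [lintegral_enorm_toLp_sq_eq_ofReal (D := fun i ω => Z (.inl i) ω - Z (.inr i) ω)
    fun i => (hZ _).sub (hZ _)]
  congr 1
  refine Finset.sum_congr rfl fun i _ => ?_
  have h (a b : I ⊕ I) : Integrable (fun ω => Z a ω * Z b ω) μ := (hZ a).integrable_mul (hZ b)
  simp only [momentMatrix, of_apply]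
  rw [← integral_const_mul, ← integral_sub (h _ _) ((h _ _).const_mul _),
    ← integral_add (f := fun ω => Z (.inl i) ω * Z (.inl i) ω - 2 * (Z (.inl i) ω * Z (.inr i) ω))
      ((h _ _).sub ((h _ _).const_mul _)) (h _ _)]
  exact integral_congr_ae (.of_forall fun ω => by simp; ring)

lemma memLp_coord {P : Measure (EuclideanSpace ℝ I)} (hP : MemLp id 2 P) (i : I) :
    MemLp (fun x : EuclideanSpace ℝ I => x i) 2 P := by
  simpa using! hP.continuousLinearMap_comp (EuclideanSpace.proj i : EuclideanSpace ℝ I →L[ℝ] ℝ)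

lemma integral_coord {P : Measure (EuclideanSpace ℝ I)} (hP : Integrable id P) (i : I) :
    ∫ x, x i ∂P = (∫ x, x ∂P) i :=
  (EuclideanSpace.proj i : EuclideanSpace ℝ I →L[ℝ] ℝ).integral_comp_comm hP

lemma covarianceBilin_eq_secondMoment {P : Measure (EuclideanSpace ℝ I)} [IsFiniteMeasure P]
    (hP : MemLp id 2 P) (hmean : ∫ x, x ∂P = 0) (u v : EuclideanSpace ℝ I) :
    covarianceBilin P u v = ofLp u ⬝ᵥ (secondMoment P *ᵥ ofLp v) := by
  rw [covarianceBilin_apply hP, ← integral_dotProduct_mul_dotProduct (memLp_coord hP)]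
  refine integral_congr_ae (.of_forall fun z => ?_)
  simp [hmean, EuclideanSpace.inner_eq_star_dotProduct, dotProduct_comm]

/-- Centred Gaussian distributions are determined by their second moments. -/
lemma isGaussian_ext_secondMoment {P Q : Measure (EuclideanSpace ℝ I)} [IsGaussian P]
    [IsGaussian Q] (hP : ∫ x, x ∂P = 0) (hQ : ∫ x, x ∂Q = 0)
    (h : secondMoment P = secondMoment Q) : P = Q := by
  refine IsGaussian.ext (hP.trans hQ.symm) ?_
  ext u v
  rw [covarianceBilin_eq_secondMoment IsGaussian.memLp_two_id hP,
    covarianceBilin_eq_secondMoment IsGaussian.memLp_two_id hQ, h]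

/-- Selection and reindexing of coordinates. -/
noncomputable def selectCoords (e : I → n) : EuclideanSpace ℝ n →L[ℝ] EuclideanSpace ℝ I :=
  LinearMap.toContinuousLinearMap
    { toFun := fun x => toLp 2 fun i => x (e i)
      map_add' := fun x y => by ext; simp
      map_smul' := fun c x => by ext; simp }

lemma secondMoment_map_selectCoords (e : I → n) (P : Measure (EuclideanSpace ℝ n)) :
    secondMoment (P.map (selectCoords e)) = (secondMoment P).submatrix e e := by
  ext i j
  simp only [momentMatrix, of_apply, submatrix_apply]
  rw [integral_map (by fun_prop) (by fun_prop)]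
  rfl

lemma integral_map_selectCoords_eq_zero (e : I → n) {P : Measure (EuclideanSpace ℝ n)}
    [IsGaussian P] (hP : ∫ x, x ∂P = 0) : ∫ x, x ∂(P.map (selectCoords e)) = 0 := by
  rw [(selectCoords e).integral_id_map IsGaussian.integrable_id]
  simp [hP]

lemma secondMoment_multivariateGaussian [DecidableEq n] {J : Matrix n n ℝ} (hJ : J.PosSemidef) :
    secondMoment (multivariateGaussian 0 J) = J := by
  ext i j
  rw [← covariance_eval_multivariateGaussian (μ := 0) hJ i j,
    covariance_eq_sub (memLp_coord IsGaussian.memLp_two_id i)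
      (memLp_coord IsGaussian.memLp_two_id j), integral_coord IsGaussian.integrable_id]
  simp [momentMatrix]

end Moments

/-! ### The Wasserstein ball in terms of coupling moments -/

section AmbiguitySet

open Matrix WithLp

variable {I : Type*} [Fintype I]

/-- Every coupling moment matrix of cost at most `ρ²` is attained by a jointly Gaussian coupling. -/
lemma exists_gaussian_mem_ambiguitySet {P₀ : Measure (EuclideanSpace ℝ I)}
    [IsGaussian P₀] (hmean : ∫ x, x ∂P₀ = 0) {ρ : ℝ} (hρ : 0 ≤ ρ)
    {J : Matrix (I ⊕ I) (I ⊕ I) ℝ} (hJ : J ∈ couplingMoments (secondMoment P₀) (ρ ^ 2)) :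
    ∃ P ∈ ambiguitySet P₀ ρ, IsGaussian P ∧ ∫ x, x ∂P = 0 ∧
      secondMoment P = J.toBlocks₁₁ := by
  classical
  obtain ⟨hJ, hJ₀, hJc⟩ := hJ
  set N := multivariateGaussian (0 : EuclideanSpace ℝ (I ⊕ I)) J with hN
  have hN0 : ∫ x, x ∂N = 0 := by simp [hN]
  have hNJ : secondMoment N = J := secondMoment_multivariateGaussian hJ
  -- Gaussianity of the nominal distribution enters here: agreement of second moments suffices to
  -- identify the second marginal with `P₀`.
  have hsnd : N.map (selectCoords Sum.inr) = P₀ := by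
    refine isGaussian_ext_secondMoment (integral_map_selectCoords_eq_zero _ hN0) hmean ?_
    rw [secondMoment_map_selectCoords, hNJ, ← hJ₀]
    rfl
  refine ⟨N.map (selectCoords Sum.inl), ⟨inferInstance, IsGaussian.memLp_two_id, ?_⟩,
    inferInstance, integral_map_selectCoords_eq_zero _ hN0, ?_⟩
  · have hγ : N.map (fun x => (selectCoords Sum.inl x, selectCoords Sum.inr x)) ∈
        couplings (N.map (selectCoords Sum.inl)) P₀ := by
      refine ⟨?_, ?_⟩
      · rw [Measure.map_map (by fun_prop) (by fun_prop)]; rfl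
      · rw [Measure.map_map (by fun_prop) (by fun_prop), ← hsnd]; rfl
    have hle : (⨅ γ ∈ couplings (N.map (selectCoords Sum.inl)) P₀,
        ∫⁻ z, ‖z.1 - z.2‖ₑ ^ 2 ∂γ) ≤ ENNReal.ofReal (ρ ^ 2) := by
      refine (iInf₂_le _ hγ).trans ?_
      rw [lintegral_map (by fun_prop) (by fun_prop)]
      refine le_trans (le_of_eq ?_) (ENNReal.ofReal_le_ofReal hJc)
      rw [← hNJ, ← lintegral_enorm_sub_sq_eq_transportCost (memLp_coord IsGaussian.memLp_two_id)]
      rfl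
    calc W2 _ P₀ ≤ ENNReal.ofReal (ρ ^ 2) ^ (1 / 2 : ℝ) := ENNReal.rpow_le_rpow hle (by norm_num)
      _ = ENNReal.ofReal ρ := by
        rw [ENNReal.ofReal_rpow_of_nonneg (by positivity) (by norm_num), ← Real.sqrt_eq_rpow,
          Real.sqrt_sq hρ]
  · rw [secondMoment_map_selectCoords, hNJ]
    rfl

/-- The infimum defining `W2` need not be known to be attained, so a near-optimal coupling is used,
at the price of the slack `δ`. -/
lemma exists_approx_couplingMoments {P₀ P : Measure (EuclideanSpace ℝ I)}
    (hP₀ : MemLp id 2 P₀) {ρ : ℝ} (hρ : 0 ≤ ρ) (hP : P ∈ ambiguitySet P₀ ρ) {δ : ℝ} (hδ : 0 < δ) :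
    ∃ J ∈ couplingMoments (secondMoment P₀) (ρ ^ 2 + δ), J.toBlocks₁₁ = secondMoment P := by
  obtain ⟨hPprob, hP2, hW⟩ := hP
  have hlt : (⨅ γ ∈ couplings P P₀, ∫⁻ z, ‖z.1 - z.2‖ₑ ^ 2 ∂γ) < ENNReal.ofReal (ρ ^ 2 + δ) := by
    have h1 := ENNReal.rpow_le_rpow hW (z := 2) (by norm_num)
    rw [W2, ← ENNReal.rpow_mul, ENNReal.rpow_two, ← ENNReal.ofReal_pow hρ] at h1
    norm_num at h1
    refine lt_of_le_of_lt h1 ((ENNReal.ofReal_lt_ofReal_iff (by positivity)).2 (by linarith))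
  obtain ⟨γ, hγ, hcost⟩ := by simpa only [iInf_lt_iff] using hlt
  obtain ⟨⟨hγ1, hγ2⟩, hcost⟩ := (⟨hγ, hcost⟩ : _ ∧ _)
  let Z : I ⊕ I → EuclideanSpace ℝ I × EuclideanSpace ℝ I → ℝ :=
    Sum.elim (fun i z => z.1 i) (fun i z => z.2 i)
  have hZ (a : I ⊕ I) : MemLp (Z a) 2 γ := by
    rcases a with i | i
    · have := memLp_coord hP2 i
      rw [← hγ1] at this
      exact this.comp_of_map (by fun_prop)
    · have := memLp_coord hP₀ i
      rw [← hγ2] at this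
      exact this.comp_of_map (by fun_prop)
  refine ⟨momentMatrix Z γ, ⟨posSemidef_momentMatrix hZ, ?_, ?_⟩, ?_⟩
  · ext i j
    simp only [secondMoment, momentMatrix, toBlocks₂₂, of_apply]
    conv_rhs => rw [← hγ2, integral_map (by fun_prop) (by fun_prop)]
    rfl
  · have h := lintegral_enorm_sub_sq_eq_transportCost hZ
    have h2 : ∫⁻ z, ‖z.1 - z.2‖ₑ ^ 2 ∂γ = ENNReal.ofReal (transportCost (momentMatrix Z γ)) := by
      rw [← h]; rfl
    rw [h2] at hcost
    exact (ENNReal.ofReal_lt_ofReal_iff (by positivity)).1 hcost |>.le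
  · ext i j
    simp only [secondMoment, momentMatrix, toBlocks₁₁, of_apply]
    conv_rhs => rw [← hγ1, integral_map (by fun_prop) (by fun_prop)]
    rfl

/-- The second moments of a distribution in the ambiguity set come from a coupling moment matrix
of cost at most `ρ²`. -/
lemma exists_couplingMoments {P₀ P : Measure (EuclideanSpace ℝ I)}
    (hP₀ : MemLp id 2 P₀) {ρ : ℝ} (hρ : 0 ≤ ρ) (hP : P ∈ ambiguitySet P₀ ρ) :
    ∃ J ∈ couplingMoments (secondMoment P₀) (ρ ^ 2), J.toBlocks₁₁ = secondMoment P := by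
  have hcl : IsClosed {J : Matrix (I ⊕ I) (I ⊕ I) ℝ | J.toBlocks₁₁ = secondMoment P} :=
    isClosed_eq (by unfold toBlocks₁₁; fun_prop) continuous_const
  obtain ⟨J₁, hJ₁, hJ₁'⟩ := exists_approx_couplingMoments hP₀ hρ hP one_pos
  -- Minimize the cost over the compact slice with slack `1`. Near-optimal couplings of slack `min δ
  -- 1` lie in the same slice, so the minimum is at most `ρ ^ 2 + δ` for every `δ > 0`.
  obtain ⟨J, ⟨hJ, hJ'⟩, hmin⟩ := ((isCompact_couplingMoments _ _).inter_right hcl).exists_isMinOn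
    ⟨J₁, hJ₁, hJ₁'⟩ continuous_transportCost.continuousOn
  refine ⟨J, ⟨hJ.1, hJ.2.1, le_of_forall_pos_le_add fun δ hδ => ?_⟩, hJ'⟩
  obtain ⟨J₂, hJ₂, hJ₂'⟩ := exists_approx_couplingMoments hP₀ hρ hP (lt_min hδ one_pos)
  have h := hmin ⟨⟨hJ₂.1, hJ₂.2.1, hJ₂.2.2.trans (by gcongr; exact min_le_right _ _)⟩, hJ₂'⟩
  exact (h : transportCost J ≤ transportCost J₂).trans
    (hJ₂.2.2.trans (by gcongr; exact min_le_left _ _))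

end AmbiguitySet

end DRFilter
namespace DRFilter

/-! ### Uncorrelated linear errors are optimal under a Gaussian law -/

section GaussianEstimation

open Matrix WithLp

variable {I κ : Type*} [Fintype I] [Fintype κ]

/-- The linear functional `x ↦ u ⬝ x` on Euclidean space. -/
noncomputable def dotCLM (u : I → ℝ) : EuclideanSpace ℝ I →L[ℝ] ℝ :=
  innerSL ℝ (toLp 2 u : EuclideanSpace ℝ I)

lemma dotCLM_apply (u : I → ℝ) (x : EuclideanSpace ℝ I) : dotCLM u x = u ⬝ᵥ ofLp x := by
  simp [dotCLM, EuclideanSpace.inner_eq_star_dotProduct, dotProduct_comm]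

lemma memLp_dotCLM {P : Measure (EuclideanSpace ℝ I)} (hP : MemLp id 2 P) (u : I → ℝ) :
    MemLp (dotCLM u) 2 P := by
  simpa using! hP.continuousLinearMap_comp (dotCLM u)

lemma integral_dotCLM_mul {P : Measure (EuclideanSpace ℝ I)} (hP : MemLp id 2 P)
    (u v : I → ℝ) : ∫ x, dotCLM u x * dotCLM v x ∂P = u ⬝ᵥ (secondMoment P *ᵥ v) := by
  simp_rw [dotCLM_apply]
  exact integral_dotProduct_mul_dotProduct (memLp_coord hP) u v

lemma integral_dotCLM_eq_zero {P : Measure (EuclideanSpace ℝ I)} (hP : Integrable id P)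
    (hmean : ∫ x, x ∂P = 0) (u : I → ℝ) : ∫ x, dotCLM u x ∂P = 0 := by
  have h := (dotCLM u).integral_comp_comm hP
  simp only [id] at h
  rw [h, hmean, map_zero]

/-- If the error of an estimator is independent of the observations, centred and square
integrable, adding a function of the observations does not decrease the mean-squared error. -/
lemma lintegral_enorm_sq_le_add_of_indepFun {Ω : Type*} {mΩ : MeasurableSpace Ω} {μ : Measure Ω}
    {X D : Ω → ℝ} (hX : MemLp X 2 μ) (hD : AEStronglyMeasurable D μ) (hX0 : ∫ ω, X ω ∂μ = 0)
    (h : IndepFun X D μ) : ∫⁻ ω, ‖X ω‖ₑ ^ 2 ∂μ ≤ ∫⁻ ω, ‖D ω + X ω‖ₑ ^ 2 ∂μ := by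
  by_cases hfin : ∫⁻ ω, ‖D ω + X ω‖ₑ ^ 2 ∂μ = ∞
  · rw [hfin]; exact le_top
  have hsum : MemLp (fun ω => D ω + X ω) 2 μ := by
    refine ⟨hD.add hX.1, ?_⟩
    rw [eLpNorm_lt_top_iff_lintegral_rpow_enorm_lt_top (by norm_num) (by norm_num)]
    simpa using lt_top_iff_ne_top.2 hfin
  -- `D` is only assumed measurable; a finite right-hand side forces it to be square integrable,
  -- which makes the cross term legitimate.
  have hD2 : MemLp D 2 μ := by
    convert! hsum.sub hX using 1
    ext ω; simp
  rw [lintegral_enorm_sq_eq_ofReal_integral hX, lintegral_enorm_sq_eq_ofReal_integral hsum]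
  refine ENNReal.ofReal_le_ofReal ?_
  have hcross : ∫ ω, X ω * D ω ∂μ = 0 := by
    rw [h.integral_fun_mul_eq_mul_integral hX.1 hD, hX0, zero_mul]
  have hXD : Integrable (fun ω => X ω * D ω) μ := hX.integrable_mul hD2
  have : ∫ ω, (D ω + X ω) ^ 2 ∂μ = ∫ ω, X ω ^ 2 ∂μ + (2 * ∫ ω, X ω * D ω ∂μ + ∫ ω, D ω ^ 2 ∂μ) := by
    rw [← integral_const_mul, ← integral_add (hXD.const_mul 2) hD2.integrable_sq,
      ← integral_add (g := fun ω => 2 * (X ω * D ω) + D ω ^ 2) hX.integrable_sq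
        ((hXD.const_mul 2).add hD2.integrable_sq)]
    exact integral_congr_ae (.of_forall fun ω => by simp; ring)
  rw [this, hcross]
  have : 0 ≤ ∫ ω, D ω ^ 2 ∂μ := integral_nonneg fun ω => sq_nonneg _
  linarith

/-- Under a centred Gaussian distribution, a linear error that is uncorrelated with the linear
observations cannot be improved by any measurable function of the observations. -/
lemma lintegral_enorm_sq_dotCLM_le {P : Measure (EuclideanSpace ℝ I)} [IsGaussian P]
    (hmean : ∫ x, x ∂P = 0) (u : I → ℝ) (v : κ → I → ℝ)
    (horth : ∀ b, v b ⬝ᵥ (secondMoment P *ᵥ u) = 0) {φ : (κ → ℝ) → ℝ} (hφ : Measurable φ) :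
    ∫⁻ x, ‖dotCLM u x‖ₑ ^ 2 ∂P ≤ ∫⁻ x, ‖φ (fun b => dotCLM (v b) x) + dotCLM u x‖ₑ ^ 2 ∂P := by
  have hP : MemLp id 2 P := IsGaussian.memLp_two_id
  have hgauss : HasGaussianLaw (fun x : EuclideanSpace ℝ I =>
      ((fun _ : Unit => dotCLM u x), fun b => dotCLM (v b) x)) P :=
    (IsGaussian.hasGaussianLaw_id (μ := P)).map_fun
      ((ContinuousLinearMap.pi fun _ : Unit => dotCLM u).prod
        (ContinuousLinearMap.pi fun b => dotCLM (v b)))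
  have hind := hgauss.indepFun_of_covariance_eval (X := fun _ : Unit => dotCLM u)
    (Y := fun b => dotCLM (v b)) fun _ b => by
      rw [covariance_eq_sub (memLp_dotCLM hP u) (memLp_dotCLM hP (v b)),
        integral_dotCLM_eq_zero IsGaussian.integrable_id hmean, zero_mul, sub_zero]
      simp only [Pi.mul_apply, mul_comm (dotCLM u _)]
      rw [integral_dotCLM_mul hP, horth]
  exact lintegral_enorm_sq_le_add_of_indepFun (memLp_dotCLM hP u)
    (by fun_prop : Measurable fun x => φ fun b => dotCLM (v b) x).aestronglyMeasurable
    (integral_dotCLM_eq_zero IsGaussian.integrable_id hmean u)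
    (hind.comp (φ := fun w : Unit → ℝ => w ()) (ψ := φ) (by fun_prop) hφ)

end GaussianEstimation

/-! ### The state-space model as a linear map of the disturbance -/

section LinearModel

open Matrix WithLp

variable {dx dw dy ds T : ℕ} (S : StateSpace dx dw dy ds)

lemma processNoise_add (ξ η : Dist dx dw dy T) (t : ℕ) :
    processNoise (ξ + η) t = processNoise ξ t + processNoise η t := by
  unfold processNoise
  split_ifs <;> ext <;> simp

lemma processNoise_smul (c : ℝ) (ξ : Dist dx dw dy T) (t : ℕ) :
    processNoise (c • ξ) t = c • processNoise ξ t := by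
  unfold processNoise
  split_ifs <;> ext <;> simp

lemma state_add (ξ η : Dist dx dw dy T) (t : ℕ) :
    state S (ξ + η) t = state S ξ t + state S η t := by
  induction t with
  | zero => ext; simp [state, initialState]
  | succ t ih => simp only [state, ih, processNoise_add, mulVec_add]; abel

lemma state_smul (c : ℝ) (ξ : Dist dx dw dy T) (t : ℕ) :
    state S (c • ξ) t = c • state S ξ t := by
  induction t with
  | zero => ext; simp [state, initialState]
  | succ t ih => simp only [state, ih, processNoise_smul, mulVec_smul, smul_add]

/-- The measurement trajectory as a linear function of the disturbance. -/
def measurementLM (T : ℕ) : Dist dx dw dy T →ₗ[ℝ] (Fin T × Fin dy → ℝ) where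
  toFun ξ b := measurement S ξ b.1 b.2
  map_add' ξ η := by
    ext b
    simp only [measurement, state_add, mulVec_add, measurementNoise, Pi.add_apply, PiLp.add_apply]
    ring
  map_smul' c ξ := by
    ext b
    simp only [measurement, state_smul, mulVec_smul, measurementNoise, Pi.add_apply,
      Pi.smul_apply, PiLp.smul_apply, smul_eq_mul, RingHom.id_apply]
    ring

/-- The target trajectory as a linear function of the disturbance. -/
def targetLM (T : ℕ) : Dist dx dw dy T →ₗ[ℝ] (Fin T × Fin ds → ℝ) where
  toFun ξ a := target S ξ a.1 a.2
  map_add' ξ η := by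
    ext a
    simp only [target, state_add, mulVec_add, Pi.add_apply]
  map_smul' c ξ := by
    ext a
    simp only [target, state_smul, mulVec_smul, Pi.smul_apply, RingHom.id_apply]

/-- The matrix of the map from disturbances to measurement trajectories. -/
noncomputable def measurementMatrix (T : ℕ) : Matrix (Fin T × Fin dy) (DistIdx dx dw dy T) ℝ :=
  Matrix.of fun b i => measurementLM S T (EuclideanSpace.single i 1) b

/-- The matrix of the map from disturbances to target trajectories. -/
noncomputable def targetMatrix (T : ℕ) : Matrix (Fin T × Fin ds) (DistIdx dx dw dy T) ℝ :=
  Matrix.of fun a i => targetLM S T (EuclideanSpace.single i 1) a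

lemma linearMap_apply_eq_dotProduct {I J : Type*} [Fintype I] [DecidableEq I]
    (L : EuclideanSpace ℝ I →ₗ[ℝ] (J → ℝ)) (x : EuclideanSpace ℝ I) (j : J) :
    L x j = (fun i => L (EuclideanSpace.single i 1) j) ⬝ᵥ ofLp x := by
  conv_lhs => rw [← (EuclideanSpace.basisFun I ℝ).sum_repr x]
  simp [dotProduct, mul_comm]

lemma measurement_eq_mulVec (ξ : Dist dx dw dy T) (b : Fin T × Fin dy) :
    measurement S ξ b.1 b.2 = (measurementMatrix S T *ᵥ ofLp ξ) b :=
  linearMap_apply_eq_dotProduct (measurementLM S T) ξ b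

lemma target_eq_mulVec (ξ : Dist dx dw dy T) (a : Fin T × Fin ds) :
    target S ξ a.1 a.2 = (targetMatrix S T *ᵥ ofLp ξ) a :=
  linearMap_apply_eq_dotProduct (targetLM S T) ξ a

lemma state_single_measurementNoise (b : Fin T × Fin dy) (t : ℕ) :
    state S (EuclideanSpace.single (Sum.inr (Sum.inr b)) 1 : Dist dx dw dy T) t = 0 := by
  induction t with
  | zero => ext; simp [state, initialState]
  | succ t ih =>
    have : processNoise (EuclideanSpace.single (Sum.inr (Sum.inr b)) 1 : Dist dx dw dy T) t = 0 := by
      unfold processNoise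
      split_ifs <;> ext <;> simp
    simp [state, ih, this]

/-- Measurement noise never feeds back into the state, so each noise coordinate reaches exactly one
measurement. This identity block is what makes the risk coercive in the filter. -/
lemma measurementMatrix_measurementNoise (b b' : Fin T × Fin dy) :
    measurementMatrix S T b (Sum.inr (Sum.inr b')) = if b = b' then 1 else 0 := by
  change measurement S _ b.1 b.2 = _
  simp [measurement, state_single_measurementNoise, measurementNoise]

lemma targetMatrix_measurementNoise (a : Fin T × Fin ds) (b : Fin T × Fin dy) :
    targetMatrix S T a (Sum.inr (Sum.inr b)) = 0 := by
  change target S _ a.1 a.2 = _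
  simp [target, state_single_measurementNoise]

/-- The causal filter that is given by a matrix; entries that are not causal are ignored. -/
noncomputable def linearFilter (K : Matrix (Fin T × Fin ds) (Fin T × Fin dy) ℝ) :
    CausalFilter dy ds T where
  toFun t y i := ∑ b : Fin T × Fin dy, K (t, i) b * if h : b.1 ≤ t then y ⟨b.1, h⟩ b.2 else 0
  measurable_toFun t := by
    refine measurable_pi_lambda _ fun i => Finset.measurable_sum _ fun b _ => ?_
    refine Measurable.const_mul ?_ _
    split_ifs <;> fun_prop

lemma linearFilter_estimate {K : Matrix (Fin T × Fin ds) (Fin T × Fin dy) ℝ}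
    (hK : K ∈ linearFilters dy ds T) (y : Fin T → Fin dy → ℝ) (t : Fin T) (i : Fin ds) :
    (linearFilter K).estimate y t i = (K *ᵥ fun b => y b.1 b.2) (t, i) := by
  refine Finset.sum_congr rfl fun b _ => ?_
  split_ifs with h
  · rfl
  · have h0 : K (t, i) b = 0 := hK t b.1 i b.2 (not_le.1 h)
    simp [h0]

lemma estimationError_linearFilter {K : Matrix (Fin T × Fin ds) (Fin T × Fin dy) ℝ}
    (hK : K ∈ linearFilters dy ds T) (ξ : Dist dx dw dy T) (a : Fin T × Fin ds) :
    (linearFilter K).estimate (measurement S ξ) a.1 a.2 - target S ξ a.1 a.2 =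
      dotCLM ((K * measurementMatrix S T - targetMatrix S T) a) ξ := by
  rw [linearFilter_estimate hK, target_eq_mulVec, dotCLM_apply]
  simp only [measurement_eq_mulVec]
  change (K *ᵥ (measurementMatrix S T *ᵥ ofLp ξ)) a - _ =
    ((K * measurementMatrix S T - targetMatrix S T) *ᵥ ofLp ξ) a
  rw [sub_mulVec, mulVec_mulVec]
  rfl

lemma mse_linearFilter {K : Matrix (Fin T × Fin ds) (Fin T × Fin dy) ℝ}
    (hK : K ∈ linearFilters dy ds T) {P : Measure (Dist dx dw dy T)} (hP : MemLp id 2 P) :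
    mse S (linearFilter K) P =
      ENNReal.ofReal (linearRisk (measurementMatrix S T) (targetMatrix S T) K (secondMoment P)) := by
  simp only [mse, estimationError, estimationError_linearFilter S hK]
  rw [lintegral_enorm_toLp_sq_eq_ofReal
    (D := fun a => dotCLM ((K * measurementMatrix S T - targetMatrix S T) a))
    fun a => memLp_dotCLM hP _]
  congr 1
  refine Finset.sum_congr rfl fun a _ => ?_
  simp_rw [sq]
  exact integral_dotCLM_mul hP _ _

lemma measurable_measurement (t : Fin T) :
    Measurable fun ξ : Dist dx dw dy T => measurement S ξ t := by
  refine measurable_pi_lambda _ fun j => ?_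
  have : (fun ξ : Dist dx dw dy T => measurement S ξ t j) =
      dotCLM (measurementMatrix S T (t, j)) := by
    ext ξ
    rw [dotCLM_apply]
    exact measurement_eq_mulVec S ξ (t, j)
  rw [this]
  fun_prop

lemma measurable_error (π : CausalFilter dy ds T) (a : Fin T × Fin ds) :
    Measurable fun ξ : Dist dx dw dy T =>
      π.estimate (measurement S ξ) a.1 a.2 - target S ξ a.1 a.2 := by
  refine Measurable.sub ?_ ?_
  · exact (measurable_pi_apply a.2).comp ((π.measurable_toFun a.1).comp
      (measurable_pi_lambda _ fun r => measurable_measurement S r.1))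
  · simp only [target_eq_mulVec]
    have : (fun ξ : Dist dx dw dy T => (targetMatrix S T *ᵥ ofLp ξ) a) =
        dotCLM (targetMatrix S T a) := by
      ext ξ
      rw [dotCLM_apply]
      rfl
    rw [this]
    fun_prop

/-- Under a centred Gaussian distribution, a linear causal filter that satisfies the normal
equations is optimal among all causal filters. -/
lemma mse_linearFilter_le_of_normal_equations
    {K : Matrix (Fin T × Fin ds) (Fin T × Fin dy) ℝ}
    (hK : K ∈ linearFilters dy ds T) {P : Measure (Dist dx dw dy T)} [IsGaussian P]
    (hmean : ∫ ξ, ξ ∂P = 0)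
    (horth : ∀ (a : Fin T × Fin ds) (b : Fin T × Fin dy), b.1 ≤ a.1 →
      measurementMatrix S T b ⬝ᵥ
        (secondMoment P *ᵥ (K * measurementMatrix S T - targetMatrix S T) a) = 0)
    (π : CausalFilter dy ds T) : mse S (linearFilter K) P ≤ mse S π P := by
  unfold mse estimationError
  rw [lintegral_enorm_toLp_sq fun a => (measurable_error S _ a).aemeasurable,
    lintegral_enorm_toLp_sq fun a => (measurable_error S _ a).aemeasurable]
  refine Finset.sum_le_sum fun a _ => ?_
  let past (y : {b : Fin T × Fin dy // b.1 ≤ a.1} → ℝ) (r : {r : Fin T // r ≤ a.1})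
    (j : Fin dy) : ℝ := y ⟨(r.1, j), r.2⟩
  have hpast : Measurable past := by fun_prop
  -- The difference of the two estimates depends only on measurements up to time `a.1`, precisely
  -- those covered by the normal equations of row `a`; adding it to the linear error gives the error
  -- of `π`.
  let φ (y : {b : Fin T × Fin dy // b.1 ≤ a.1} → ℝ) : ℝ :=
    π.toFun a.1 (past y) a.2 - (linearFilter K).toFun a.1 (past y) a.2
  have hφ : Measurable φ :=
    ((measurable_pi_apply _).comp ((π.measurable_toFun a.1).comp hpast)).sub
      ((measurable_pi_apply _).comp (((linearFilter K).measurable_toFun a.1).comp hpast))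
  have h := lintegral_enorm_sq_dotCLM_le hmean
    ((K * measurementMatrix S T - targetMatrix S T) a)
    (fun b : {b : Fin T × Fin dy // b.1 ≤ a.1} => measurementMatrix S T b.1)
    (fun b => horth a b.1 b.2) hφ
  simp only [← estimationError_linearFilter S hK] at h
  refine h.trans (le_of_eq (lintegral_congr fun ξ => ?_))
  have hp : past (fun b => dotCLM (measurementMatrix S T b.1) ξ) =
      fun r => measurement S ξ r.1 := by
    ext r j
    simp only [past, dotCLM_apply]
    exact (measurement_eq_mulVec S ξ (r.1, j)).symm
  simp only [φ, hp, CausalFilter.estimate, sub_add_sub_cancel]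

end LinearModel

end DRFilter

/-- Minimax duality for Wasserstein-2 distributionally robust filtering with a centred Gaussian
nominal distribution, with a saddle point that consists of a linear causal filter and a (centred)
Gaussian distribution. -/
theorem theorem3p1 (dx dw dy ds T : ℕ) (hT : 0 < T)
    (S : DRFilter.StateSpace dx dw dy ds)
    (P₀ : MeasureTheory.Measure (DRFilter.Dist dx dw dy T))
    (hP₀ : ProbabilityTheory.IsGaussian P₀) (hmean : ∫ ξ, ξ ∂P₀ = 0)
    (ρ : ℝ) (hρ : 0 < ρ) :
    (⨅ π : DRFilter.CausalFilter dy ds T, ⨆ P ∈ DRFilter.ambiguitySet P₀ ρ,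
        DRFilter.mse S π P) =
      (⨆ P ∈ DRFilter.ambiguitySet P₀ ρ, ⨅ π : DRFilter.CausalFilter dy ds T,
        DRFilter.mse S π P) ∧
    ∃ (πs : DRFilter.CausalFilter dy ds T)
      (Ps : MeasureTheory.Measure (DRFilter.Dist dx dw dy T)),
      Ps ∈ DRFilter.ambiguitySet P₀ ρ ∧
      πs.IsLinear ∧
      ProbabilityTheory.IsGaussian Ps ∧ ∫ ξ, ξ ∂Ps = 0 ∧
      (∀ P ∈ DRFilter.ambiguitySet P₀ ρ, DRFilter.mse S πs P ≤ DRFilter.mse S πs Ps) ∧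
      (∀ π : DRFilter.CausalFilter dy ds T, DRFilter.mse S πs Ps ≤ DRFilter.mse S π Ps) := by
  have hP₀2 : MemLp id 2 P₀ := IsGaussian.memLp_two_id
  obtain ⟨K, hK, J, hJ, hmax, horth⟩ := DRFilter.exists_linear_saddle
    (fun (a : Fin T × Fin ds) (b : Fin T × Fin dy) => b.1 ≤ a.1)
    (DRFilter.measurementMatrix S T) (DRFilter.targetMatrix S T)
    (fun b => Sum.inr (Sum.inr b)) (DRFilter.measurementMatrix_measurementNoise S)
    (DRFilter.targetMatrix_measurementNoise S)
    (DRFilter.posSemidef_momentMatrix (DRFilter.memLp_coord hP₀2)) (pow_pos hρ 2)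
  have hKlin : K ∈ DRFilter.linearFilters dy ds T :=
    fun t r i j htr => hK (t, i) (r, j) (not_le.2 htr)
  obtain ⟨Ps, hPs, hPsG, hPs0, hPsJ⟩ :=
    DRFilter.exists_gaussian_mem_ambiguitySet hmean hρ.le hJ
  have hupper : ∀ P ∈ DRFilter.ambiguitySet P₀ ρ,
      DRFilter.mse S (DRFilter.linearFilter K) P ≤
        DRFilter.mse S (DRFilter.linearFilter K) Ps := by
    intro P hP
    obtain ⟨J', hJ', hJP⟩ := DRFilter.exists_couplingMoments hP₀2 hρ.le hP
    rw [DRFilter.mse_linearFilter S hKlin hP.2.1, DRFilter.mse_linearFilter S hKlin hPs.2.1,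
      ← hJP, hPsJ]
    exact ENNReal.ofReal_le_ofReal (hmax J' hJ')
  have hlower : ∀ π : DRFilter.CausalFilter dy ds T,
      DRFilter.mse S (DRFilter.linearFilter K) Ps ≤ DRFilter.mse S π Ps :=
    DRFilter.mse_linearFilter_le_of_normal_equations S hKlin hPs0 (by rwa [hPsJ])
  refine ⟨le_antisymm ?_ ?_, DRFilter.linearFilter K, Ps, hPs,
    ⟨K, hKlin, DRFilter.linearFilter_estimate hKlin⟩, hPsG, hPs0, hupper, hlower⟩
  -- The saddle point closes the duality gap; the reverse inequality below is weak duality.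
  · calc (⨅ π : DRFilter.CausalFilter dy ds T, ⨆ P ∈ DRFilter.ambiguitySet P₀ ρ,
          DRFilter.mse S π P)
        ≤ ⨆ P ∈ DRFilter.ambiguitySet P₀ ρ, DRFilter.mse S (DRFilter.linearFilter K) P :=
        iInf_le _ _
      _ ≤ DRFilter.mse S (DRFilter.linearFilter K) Ps := iSup₂_le hupper
      _ ≤ ⨅ π, DRFilter.mse S π Ps := le_iInf hlower
      _ ≤ _ := le_iSup₂ (f := fun P _ => ⨅ π, DRFilter.mse S π P) Ps hPs
  · exact iSup₂_le fun P hP => le_iInf fun π => (iInf_le _ π).trans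
      (le_iSup₂ (f := fun P _ => DRFilter.mse S π P) P hP)
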